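/- Let $n\in\mathbb N$, let $e_1,\dots,e_n$ be the standard basis vectors of $\mathbb R^n$ (the vertices of the regular $n$-simplex; these are the terminals), and let $T$ be a Steiner topology on these terminals: a finite tree whose vertices are the $n$ terminals together with finitely many further vertices, called Steiner points, each Steiner point having degree at least $3$. Place the vertices of $T$ in $\mathbb R^n$, each terminal at its own position $e_i$ and the Steiner points so that the sum of the Euclidean lengths of the edges of $T$ is minimal among all placements of the Steiner points (that is, $T$ is a relatively minimal Steiner tree of the regular $n$-simplex). Let $r$ be a Steiner point and $q$ a neighbour of $r$ in $T$, and let $T'$ be the subtree of $T$ consisting of $r$ and all its descendants when $q$ is regarded as the parent of $r$. Suppose that $T'$, rooted at $r$, is a full binary tree, meaning that for some height $h$ every leaf of $T'$ has depth $h$ and every other vertex has exactly two children (so $T'$ has $2^h$ leaves), that all leaves of $T'$ are terminals, and that all other vertices of $T'$ are Steiner points. Let $P(T')$ be the set of terminals in $T'$, and let $e_{T'}=(r,q)$ be the edge at $r$ that does not lie in $T'$. Then: 1. For every Steiner point $s=(s_1,\dots,s_n)$ that is not in $T'$ or is equal to $r$, and for all $i,j$ with $e_i,e_j\in P(T')$,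 we have $s_i=s_j$. 2. The line $\ell_{T'}$ extending the edge $e_{T'}$ (the line through the positions of $r$ and $q$, defined when these two points are distinct) passes through the centroid $\frac{1}{|P(T')|}\sum_{e_i\in P(T')}e_i$ of the terminals in $P(T')$. -/

import Mathlib

/-- The topology of a Steiner tree with terminals labelled by `ι` and Steiner points labelled by
`S`: a tree on the terminals and Steiner points in which no Steiner point is trivial (a leaf, or a
point that subdivides an edge). -/
structure IsSteinerTopology {ι S : Type*} (T : SimpleGraph (ι ⊕ S)) : Prop where
  isTree : T.IsTree
  three_le_degree : ∀ s : S, 3 ≤ (T.neighborSet (Sum.inr s)).ncard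

open Classical in
/-- The total Euclidean length of the edges of `T` when its vertices are placed at the points
`x`. -/
noncomputable def treeLength {V E : Type*} [Fintype V] [MetricSpace E]
    (T : SimpleGraph V) (x : V → E) : ℝ :=
  ∑ e ∈ T.edgeFinset, Sym2.lift ⟨fun u v => dist (x u) (x v), fun _ _ => dist_comm _ _⟩ e

/-- `x` realizes the topology `T` on the terminals `p` (the terminals are at their prescribed
places, the Steiner points anywhere) with the least length among all such realizations. -/
structure IsRelativelyMinimal {ι S E : Type*} [Fintype ι] [Fintype S] [MetricSpace E]
    (T : SimpleGraph (ι ⊕ S)) (p : ι → E) (x : ι ⊕ S → E) : Prop where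
  terminal : ∀ i, x (Sum.inl i) = p i
  minimal : ∀ y : ι ⊕ S → E, (∀ i, y (Sum.inl i) = p i) → treeLength T x ≤ treeLength T y

/-- The vertices of the regular `n`-simplex: the standard basis vectors of `ℝⁿ`. -/
noncomputable def simplexVertex (n : ℕ) (i : Fin n) : EuclideanSpace ℝ (Fin n) :=
  EuclideanSpace.single i 1

/-- `IsFullBinarySubtree T h q r W`: here `q` is a neighbour of `r`, and `W` is the set of vertices
of the subtree of `T` that consists of `r` and all its descendants when `q` is regarded as the
parent of `r`. This subtree, rooted at `r`, is a full binary tree of height `h` (every leaf has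
depth `h`, every other vertex has exactly two children) whose leaves are terminals and whose other
vertices are Steiner points. -/
inductive IsFullBinarySubtree {ι S : Type*} (T : SimpleGraph (ι ⊕ S)) :
    ℕ → ι ⊕ S → ι ⊕ S → Set (ι ⊕ S) → Prop
  | leaf (q : ι ⊕ S) (i : ι) (hi : T.neighborSet (Sum.inl i) = {q}) :
      IsFullBinarySubtree T 0 q (Sum.inl i) {Sum.inl i}
  | node (h : ℕ) (q : ι ⊕ S) (s : S) (a b : ι ⊕ S) (A B : Set (ι ⊕ S))
      (hs : T.neighborSet (Sum.inr s) = {q, a, b}) (hqa : q ≠ a) (hqb : q ≠ b) (hab : a ≠ b)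
      (hA : IsFullBinarySubtree T h (Sum.inr s) a A)
      (hB : IsFullBinarySubtree T h (Sum.inr s) b B) :
      IsFullBinarySubtree T (h + 1) q (Sum.inr s) ({Sum.inr s} ∪ A ∪ B)

open Classical in
/-- The (labels of the) terminals that lie in the vertex set `W`. -/
noncomputable def terminalsIn {ι S : Type*} [Fintype ι] (W : Set (ι ⊕ S)) : Finset ι :=
  Finset.univ.filter fun i => Sum.inl i ∈ W

/-! Part 1. Sibling subtrees of equal height are isomorphic, so swapping them is an automorphism of
`T` fixing all else (`exists_automorphism`). Combined with the matching coordinate permutation, it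
turns `x` into another minimal placement `y`. By strict convexity, edges of equal length in two
minimal placements agree as vectors (`sub_eq_sub`). So `x - y` is constant along edges outside the
siblings; were it nonzero somewhere, it would spread through Steiner points without ever meeting a
terminal, which the degree condition forbids (`eq_empty_of_closed`). Hence `x v` is invariant under
the permutation, and induction on the height gives equal coordinates (`coord_eq_coord`).

Part 2. By part 1 and `sum_coord`, the ends of the edge are `(1 - f ξ) • c + ξ` and `(1 - f η) • c +
η`, with `c` the centroid, `f` the coordinate sum, and `ξ`, `η` vanishing on the terminals of `W`.
Isometries fixing those terminals can move the subtree at the cost of one edge only, so minimality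
puts `ξ` and `η` on a common ray. Then the line through the two ends contains `c`. -/

/-! ### Full binary subtrees and their symmetries. -/

section Combinatorics

variable {ι S : Type*} {T : SimpleGraph (ι ⊕ S)}

namespace IsFullBinarySubtree

variable {h : ℕ} {q r : ι ⊕ S} {W : Set (ι ⊕ S)}

lemma root_mem (hW : IsFullBinarySubtree T h q r W) : r ∈ W := by
  cases hW <;> simp

lemma adj (hW : IsFullBinarySubtree T h q r W) : T.Adj r q := by
  cases hW with
  | leaf q i hi => rw [← SimpleGraph.mem_neighborSet, hi]; simp
  | node h q s a b A B hs hqa hqb hab hA hB => rw [← SimpleGraph.mem_neighborSet, hs]; simp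

/-- The parent does not belong to the subtree, and the only edge that leaves the subtree is the one
from the root to the parent. -/
lemma notMem_and_exit (hW : IsFullBinarySubtree T h q r W) :
    q ∉ W ∧ ∀ u ∈ W, ∀ v ∉ W, T.Adj u v → u = r ∧ v = q := by
  induction hW with
  | leaf q i hi =>
    have hq : T.Adj (Sum.inl i) q := by rw [← SimpleGraph.mem_neighborSet, hi]; simp
    refine ⟨fun hm => hq.ne (Set.mem_singleton_iff.1 hm).symm, ?_⟩
    rintro u rfl v - huv
    refine ⟨rfl, ?_⟩
    rw [← SimpleGraph.mem_neighborSet, hi] at huv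
    exact huv
  | node h q s a b A B hs hqa hqb hab hA hB ihA ihB =>
    have hadj : ∀ v, T.Adj (Sum.inr s) v ↔ v = q ∨ v = a ∨ v = b := fun v => by
      rw [← SimpleGraph.mem_neighborSet, hs]; simp
    have hq : T.Adj (Sum.inr s) q := (hadj q).2 (Or.inl rfl)
    have hqA : q ∉ A := fun hm => hqa (ihA.2 q hm _ ihA.1 hq.symm).1
    have hqB : q ∉ B := fun hm => hqb (ihB.2 q hm _ ihB.1 hq.symm).1
    refine ⟨?_, ?_⟩
    · simp only [Set.mem_union, Set.mem_singleton_iff, not_or]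
      exact ⟨⟨hq.ne', hqA⟩, hqB⟩
    · intro u hu v hv huv
      simp only [Set.mem_union, Set.mem_singleton_iff, not_or] at hu hv
      obtain ⟨⟨hvs, hvA⟩, hvB⟩ := hv
      rcases hu with (rfl | hu) | hu
      · refine ⟨rfl, ?_⟩
        rcases (hadj v).1 huv with rfl | rfl | rfl
        · rfl
        · exact absurd hA.root_mem hvA
        · exact absurd hB.root_mem hvB
      · exact absurd (ihA.2 u hu v hvA huv).2 hvs
      · exact absurd (ihB.2 u hu v hvB huv).2 hvs

lemma parent_notMem (hW : IsFullBinarySubtree T h q r W) : q ∉ W := hW.notMem_and_exit.1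

lemma eq_of_adj (hW : IsFullBinarySubtree T h q r W) {u v : ι ⊕ S} (hu : u ∈ W) (hv : v ∉ W)
    (huv : T.Adj u v) : u = r ∧ v = q := hW.notMem_and_exit.2 u hu v hv huv

lemma exists_terminal (hW : IsFullBinarySubtree T h q r W) : ∃ i, Sum.inl i ∈ W := by
  induction hW with
  | leaf q i hi => exact ⟨i, rfl⟩
  | node h q s a b A B hs hqa hqb hab hA hB ihA ihB =>
    obtain ⟨i, hi⟩ := ihA
    exact ⟨i, Or.inl (Or.inr hi)⟩

/-- The subtrees at two different children of a common parent are disjoint. -/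
lemma disjoint (hT : T.Connected) {h' : ℕ} {a b : ι ⊕ S} {A B : Set (ι ⊕ S)} (hab : a ≠ b)
    (hA : IsFullBinarySubtree T h q a A) (hB : IsFullBinarySubtree T h' q b B) :
    Disjoint A B := by
  have haB : a ∉ B := fun hm => hab (hB.eq_of_adj hm hB.parent_notMem hA.adj).1
  have hbA : b ∉ A := fun hm => hab (hA.eq_of_adj hm hA.parent_notMem hB.adj).1.symm
  rw [Set.disjoint_left]
  intro v hvA hvB
  -- `A` can be left only at `a ∉ B`, and `B` only at `b ∉ A`, so no walk leaves `A ∩ B`; yet one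
  -- leads to `q`.
  have key : ∀ w, Relation.ReflTransGen T.Adj v w → w ∈ A ∧ w ∈ B := by
    intro w hw
    induction hw with
    | refl => exact ⟨hvA, hvB⟩
    | tail _ huw ih =>
      refine ⟨?_, ?_⟩
      · by_contra hw
        exact haB ((hA.eq_of_adj ih.1 hw huw).1 ▸ ih.2)
      · by_contra hw
        exact hbA ((hB.eq_of_adj ih.2 hw huw).1 ▸ ih.1)
  exact hA.parent_notMem
    (key q ((SimpleGraph.reachable_iff_reflTransGen _ _).1 (hT.preconnected v q))).1

/-- Two disjoint full binary subtrees of the same height can be exchanged. -/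
lemma exists_swap (hT : T.Connected) {p p' a b : ι ⊕ S} {A B : Set (ι ⊕ S)}
    (hA : IsFullBinarySubtree T h p a A) (hB : IsFullBinarySubtree T h p' b B)
    (hAB : Disjoint A B) :
    ∃ (π : Equiv.Perm ι) (τ : Equiv.Perm S),
      Equiv.sumCongr π τ a = b ∧ Equiv.sumCongr π τ b = a ∧
      (∀ v, v ∉ A → v ∉ B → Equiv.sumCongr π τ v = v) ∧
      (∀ v ∈ A, Equiv.sumCongr π τ v ∈ B) ∧ (∀ v ∈ B, Equiv.sumCongr π τ v ∈ A) ∧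
      (∀ u ∈ A, ∀ v ∈ A, T.Adj u v → T.Adj (Equiv.sumCongr π τ u) (Equiv.sumCongr π τ v)) ∧
      (∀ u ∈ B, ∀ v ∈ B, T.Adj u v → T.Adj (Equiv.sumCongr π τ u) (Equiv.sumCongr π τ v)) := by
  classical
  induction hA generalizing p' b B with
  | leaf q i hi =>
    cases hB with
    | leaf _ j hj =>
      refine ⟨Equiv.swap i j, 1, by simp, by simp, ?_, by simp, by simp, by simp, by simp⟩
      rintro (v | v) hv hv'
      · simp only [Set.mem_singleton_iff, Sum.inl.injEq] at hv hv'
        rw [Equiv.sumCongr_apply, Sum.map_inl, Equiv.swap_apply_of_ne_of_ne hv hv']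
      · rfl
  | node h p s a₁ a₂ A₁ A₂ hs hpa₁ hpa₂ ha hA₁ hA₂ ih₁ ih₂ =>
    cases hB with
    | node _ _ s' b₁ b₂ B₁ B₂ hs' hpb₁ hpb₂ hb hB₁ hB₂ =>
    simp only [Set.disjoint_union_left, Set.disjoint_union_right] at hAB
    obtain ⟨⟨⟨⟨-, hA₁s'⟩, hA₂s'⟩, ⟨hsB₁, hA₁B₁⟩, hA₂B₁⟩, ⟨hsB₂, hA₁B₂⟩, hA₂B₂⟩ := hAB
    rw [Set.disjoint_singleton_left] at hsB₁ hsB₂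
    rw [Set.disjoint_singleton_right] at hA₁s' hA₂s'
    have hA₁A₂ := disjoint hT ha hA₁ hA₂
    have hB₁B₂ := disjoint hT hb hB₁ hB₂
    rw [Set.disjoint_left] at hA₁B₁ hA₂B₁ hA₁B₂ hA₂B₂ hA₁A₂ hB₁B₂
    have hsA₁ := hA₁.parent_notMem
    have hsA₂ := hA₂.parent_notMem
    have hsB₁' := hB₁.parent_notMem
    have hsB₂' := hB₂.parent_notMem
    obtain ⟨π₁, τ₁, hab₁, hba₁, hfix₁, hmA₁, hmB₁, hadA₁, hadB₁⟩ :=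
      ih₁ hB₁ (Set.disjoint_left.2 hA₁B₁)
    obtain ⟨π₂, τ₂, hab₂, hba₂, hfix₂, hmA₂, hmB₂, hadA₂, hadB₂⟩ :=
      ih₂ hB₂ (Set.disjoint_left.2 hA₂B₂)
    set σ₁ := Equiv.sumCongr π₁ τ₁ with hσ₁
    set σ₂ := Equiv.sumCongr π₂ τ₂ with hσ₂
    have hσ : ∀ v, Equiv.sumCongr (π₁ * π₂) (τ₁ * τ₂ * Equiv.swap s s') v =
        σ₁ (σ₂ (Equiv.sumCongr (1 : Equiv.Perm ι) (Equiv.swap s s') v)) := by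
      rintro (v | v) <;> rfl
    have hsw : ∀ v : ι ⊕ S, v ≠ Sum.inr s → v ≠ Sum.inr s' →
        Equiv.sumCongr (1 : Equiv.Perm ι) (Equiv.swap s s') v = v := by
      rintro (v | v) h1 h2
      · rfl
      · simp only [ne_eq, Sum.inr.injEq] at h1 h2
        exact congrArg Sum.inr (Equiv.swap_apply_of_ne_of_ne h1 h2)
    -- The three factors (two inductive exchanges and the swap of the roots) have disjoint supports.
    refine ⟨π₁ * π₂, τ₁ * τ₂ * Equiv.swap s s', ?_⟩
    set σ := Equiv.sumCongr (π₁ * π₂) (τ₁ * τ₂ * Equiv.swap s s')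
    have σs : σ (Sum.inr s) = Sum.inr s' := by
      rw [hσ, show Equiv.sumCongr (1 : Equiv.Perm ι) (Equiv.swap s s') _ = Sum.inr s' from
        congrArg Sum.inr (Equiv.swap_apply_left s s'), hfix₂ _ hA₂s' hsB₂',
        hfix₁ _ hA₁s' hsB₁']
    have σs' : σ (Sum.inr s') = Sum.inr s := by
      rw [hσ, show Equiv.sumCongr (1 : Equiv.Perm ι) (Equiv.swap s s') _ = Sum.inr s from
        congrArg Sum.inr (Equiv.swap_apply_right s s'), hfix₂ _ hsA₂ hsB₂,
        hfix₁ _ hsA₁ hsB₁]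
    have σA₁ : ∀ v ∈ A₁, σ v = σ₁ v := fun v hv => by
      rw [hσ, hsw v (fun e => hsA₁ (e ▸ hv)) (fun e => hA₁s' (e ▸ hv)),
        hfix₂ v (hA₁A₂ hv) (hA₁B₂ hv)]
    have σB₁ : ∀ v ∈ B₁, σ v = σ₁ v := fun v hv => by
      rw [hσ, hsw v (fun e => hsB₁ (e ▸ hv)) (fun e => hsB₁' (e ▸ hv)),
        hfix₂ v (fun hm => hA₂B₁ hm hv) (hB₁B₂ hv)]
    have σA₂ : ∀ v ∈ A₂, σ v = σ₂ v := fun v hv => by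
      rw [hσ, hsw v (fun e => hsA₂ (e ▸ hv)) (fun e => hA₂s' (e ▸ hv)),
        hfix₁ _ (fun hm => hA₁B₂ hm (hmA₂ v hv)) (fun hm => hB₁B₂ hm (hmA₂ v hv))]
    have σB₂ : ∀ v ∈ B₂, σ v = σ₂ v := fun v hv => by
      rw [hσ, hsw v (fun e => hsB₂ (e ▸ hv)) (fun e => hsB₂' (e ▸ hv)),
        hfix₁ _ (fun hm => hA₁A₂ hm (hmB₂ v hv)) (fun hm => hA₂B₁ (hmB₂ v hv) hm)]
    have adj_s' : ∀ v, v = b₁ ∨ v = b₂ → T.Adj (Sum.inr s') v := fun v hv => by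
      rw [← SimpleGraph.mem_neighborSet, hs']; exact Or.inr hv
    have adj_s : ∀ v, v = a₁ ∨ v = a₂ → T.Adj (Sum.inr s) v := fun v hv => by
      rw [← SimpleGraph.mem_neighborSet, hs]; exact Or.inr hv
    refine ⟨σs, σs', ?_, ?_, ?_, ?_, ?_⟩
    · intro v hv hv'
      simp only [Set.mem_union, Set.mem_singleton_iff, not_or] at hv hv'
      rw [hσ, hsw v hv.1.1 hv'.1.1, hfix₂ v hv.2 hv'.2, hfix₁ v hv.1.2 hv'.1.2]
    · rintro v ((rfl | hv) | hv)
      · rw [σs]; simp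
      · rw [σA₁ v hv]; exact Or.inl (Or.inr (hmA₁ v hv))
      · rw [σA₂ v hv]; exact Or.inr (hmA₂ v hv)
    · rintro v ((rfl | hv) | hv)
      · rw [σs']; simp
      · rw [σB₁ v hv]; exact Or.inl (Or.inr (hmB₁ v hv))
      · rw [σB₂ v hv]; exact Or.inr (hmB₂ v hv)
    · have hs₁ : ∀ v ∈ A₁, T.Adj v (Sum.inr s) → T.Adj (σ v) (Sum.inr s') := fun v hv huv => by
        rw [σA₁ v hv, (hA₁.eq_of_adj hv hsA₁ huv).1, hab₁]
        exact (adj_s' _ (Or.inl rfl)).symm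
      have hs₂ : ∀ v ∈ A₂, T.Adj v (Sum.inr s) → T.Adj (σ v) (Sum.inr s') := fun v hv huv => by
        rw [σA₂ v hv, (hA₂.eq_of_adj hv hsA₂ huv).1, hab₂]
        exact (adj_s' _ (Or.inr rfl)).symm
      have h₁₂ : ∀ u ∈ A₁, ∀ v ∈ A₂, ¬ T.Adj u v := fun u hu v hv huv =>
        hsA₂ ((hA₁.eq_of_adj hu (fun hm => hA₁A₂ hm hv) huv).2 ▸ hv)
      rintro u ((rfl | hu) | hu) v ((rfl | hv) | hv) huv
      · exact absurd rfl huv.ne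
      · rw [σs]; exact (hs₁ v hv huv.symm).symm
      · rw [σs]; exact (hs₂ v hv huv.symm).symm
      · rw [σs]; exact hs₁ u hu huv
      · rw [σA₁ u hu, σA₁ v hv]; exact hadA₁ u hu v hv huv
      · exact absurd huv (h₁₂ u hu v hv)
      · rw [σs]; exact hs₂ u hu huv
      · exact absurd huv.symm (h₁₂ v hv u hu)
      · rw [σA₂ u hu, σA₂ v hv]; exact hadA₂ u hu v hv huv
    · have hs₁ : ∀ v ∈ B₁, T.Adj v (Sum.inr s') → T.Adj (σ v) (Sum.inr s) := fun v hv huv => by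
        rw [σB₁ v hv, (hB₁.eq_of_adj hv hsB₁' huv).1, hba₁]
        exact (adj_s _ (Or.inl rfl)).symm
      have hs₂ : ∀ v ∈ B₂, T.Adj v (Sum.inr s') → T.Adj (σ v) (Sum.inr s) := fun v hv huv => by
        rw [σB₂ v hv, (hB₂.eq_of_adj hv hsB₂' huv).1, hba₂]
        exact (adj_s _ (Or.inr rfl)).symm
      have h₁₂ : ∀ u ∈ B₁, ∀ v ∈ B₂, ¬ T.Adj u v := fun u hu v hv huv =>
        hsB₂' ((hB₁.eq_of_adj hu (fun hm => hB₁B₂ hm hv) huv).2 ▸ hv)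
      rintro u ((rfl | hu) | hu) v ((rfl | hv) | hv) huv
      · exact absurd rfl huv.ne
      · rw [σs']; exact (hs₁ v hv huv.symm).symm
      · rw [σs']; exact (hs₂ v hv huv.symm).symm
      · rw [σs']; exact hs₁ u hu huv
      · rw [σB₁ u hu, σB₁ v hv]; exact hadB₁ u hu v hv huv
      · exact absurd huv (h₁₂ u hu v hv)
      · rw [σs']; exact hs₂ u hu huv
      · exact absurd huv.symm (h₁₂ v hv u hu)
      · rw [σB₂ u hu, σB₂ v hv]; exact hadB₂ u hu v hv huv

/-- Two siblings are exchanged by an automorphism that fixes everything else. -/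
lemma exists_automorphism (hT : T.Connected) {a b : ι ⊕ S} {A B : Set (ι ⊕ S)} (hab : a ≠ b)
    (hA : IsFullBinarySubtree T h q a A) (hB : IsFullBinarySubtree T h q b B) :
    ∃ (π : Equiv.Perm ι) (τ : Equiv.Perm S),
      (∀ v, v ∉ A → v ∉ B → Equiv.sumCongr π τ v = v) ∧
      (∀ v ∈ A, Equiv.sumCongr π τ v ∈ B) ∧
      (∀ u v, T.Adj u v → T.Adj (Equiv.sumCongr π τ u) (Equiv.sumCongr π τ v)) := by
  have hAB := disjoint hT hab hA hB
  obtain ⟨π, τ, ha, hb, hfix, hmA, hmB, hadA, hadB⟩ := exists_swap hT hA hB hAB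
  rw [Set.disjoint_left] at hAB
  refine ⟨π, τ, hfix, hmA, ?_⟩
  have hq := hfix q hA.parent_notMem hB.parent_notMem
  set σ := Equiv.sumCongr π τ
  have exitA : ∀ u ∈ A, ∀ v ∉ A, T.Adj u v → T.Adj (σ u) (σ v) := fun u hu v hv huv => by
    obtain ⟨rfl, rfl⟩ := hA.eq_of_adj hu hv huv
    rw [ha, hq]; exact hB.adj
  have exitB : ∀ u ∈ B, ∀ v ∉ B, T.Adj u v → T.Adj (σ u) (σ v) := fun u hu v hv huv => by
    obtain ⟨rfl, rfl⟩ := hB.eq_of_adj hu hv huv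
    rw [hb, hq]; exact hA.adj
  intro u v huv
  by_cases huA : u ∈ A <;> by_cases hvA : v ∈ A
  · exact hadA u huA v hvA huv
  · exact exitA u huA v hvA huv
  · exact (exitA v hvA u huA huv.symm).symm
  · by_cases huB : u ∈ B <;> by_cases hvB : v ∈ B
    · exact hadB u huB v hvB huv
    · exact exitB u huB v hvB huv
    · exact (exitB v hvB u huB huv.symm).symm
    · rwa [hfix u huA huB, hfix v hvA hvB]

end IsFullBinarySubtree

/-- In a tree, a vertex has at most one neighbour that is closer to a given vertex. -/
lemma SimpleGraph.IsTree.eq_of_dist_lt {V : Type*} {G : SimpleGraph V} (hG : G.IsTree)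
    {r u v w : V} (hu : G.Adj v u) (hw : G.Adj v w) (hdu : G.dist r u < G.dist r v)
    (hdw : G.dist r w < G.dist r v) : u = w := by
  classical
  have key : ∀ u, G.Adj v u → G.dist r u < G.dist r v →
      ∃ p : G.Walk v r, p.IsPath ∧ p.snd = u := by
    intro u hu hdu
    obtain ⟨p, hp, hlen⟩ := (hG.connected u r).exists_path_of_dist
    refine ⟨p.cons hu, ?_, by simp⟩
    rw [SimpleGraph.Walk.cons_isPath_iff]
    refine ⟨hp, fun hm => ?_⟩
    -- If the shortest path from `u` met `v`, then `v` would be no farther from `r` than `u`.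
    have h1 := SimpleGraph.dist_le (p.dropUntil v hm)
    have h2 := p.length_dropUntil_le_length hm
    rw [G.dist_comm (u := r), G.dist_comm (u := r)] at hdu
    omega
  obtain ⟨p, hp, rfl⟩ := key u hu hdu
  obtain ⟨p', hp', rfl⟩ := key w hw hdw
  have := congrArg Subtype.val ((hG.isAcyclic.subsingleton_path v r).elim ⟨p, hp⟩ ⟨p', hp'⟩)
  simp only at this
  rw [this]

/-- A set `K` of Steiner points that contains all the neighbours of each of its elements other than
`r`, and at least one neighbour of `r` if it contains `r`, is empty. -/
lemma IsSteinerTopology.eq_empty_of_closed [Finite ι] [Finite S] (hT : IsSteinerTopology T)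
    (r : ι ⊕ S) (K : Set (ι ⊕ S)) (hK : ∀ i, Sum.inl i ∉ K)
    (hr : r ∈ K → ∃ v ∈ K, T.Adj r v)
    (hcl : ∀ u ∈ K, u ≠ r → ∀ v, T.Adj u v → v ∈ K) : K = ∅ := by
  by_contra hne
  -- At an element farthest from `r`, every neighbour is strictly closer to `r`; a tree allows only
  -- one such neighbour, against degree at least 3.
  obtain ⟨v, hv, hmax⟩ := K.toFinite.exists_maximalFor (T.dist r) K
    (Set.nonempty_iff_ne_empty.2 hne)
  have hmax' : ∀ w ∈ K, T.dist r w ≤ T.dist r v := fun w hw => by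
    rcases le_total (T.dist r w) (T.dist r v) with h | h
    · exact h
    · exact hmax hw h
  have hvr : v ≠ r := by
    rintro rfl
    obtain ⟨w, hw, hvw⟩ := hr hv
    have h1 := hmax' w hw
    have h2 := hT.isTree.dist_ne_of_adj v hvw
    simp only [SimpleGraph.dist_self] at h1 h2
    omega
  rcases v with i | s
  · exact hK i hv
  · have hsub : (T.neighborSet (Sum.inr s)).Subsingleton := by
      have hlt : ∀ w, T.Adj (Sum.inr s) w → T.dist r w < T.dist r (Sum.inr s) := fun w hw =>
        lt_of_le_of_ne (hmax' w (hcl _ hv hvr w hw)) (hT.isTree.dist_ne_of_adj r hw).symm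
      intro u hu w hw
      exact hT.isTree.eq_of_dist_lt hu hw (hlt u hu) (hlt w hw)
    have h1 := Set.ncard_le_one_iff_subsingleton.2 hsub
    have h2 := hT.three_le_degree s
    omega

end Combinatorics

/-! ### Tree length: monotonicity, symmetry, convexity. -/

section Length

variable {V E : Type*} [Fintype V]

lemma treeLength_le_of_forall [MetricSpace E] {T : SimpleGraph V} {x y : V → E}
    (h : ∀ u v, T.Adj u v → dist (y u) (y v) ≤ dist (x u) (x v)) :
    treeLength T y ≤ treeLength T x := by
  classical
  refine Finset.sum_le_sum fun e he => ?_
  induction e with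
  | _ u v => exact h u v (by simpa using he)

lemma treeLength_lt_of_forall [MetricSpace E] {T : SimpleGraph V} {x y : V → E}
    (h : ∀ u v, T.Adj u v → dist (y u) (y v) ≤ dist (x u) (x v)) {u v : V} (huv : T.Adj u v)
    (hlt : dist (y u) (y v) < dist (x u) (x v)) : treeLength T y < treeLength T x := by
  classical
  refine Finset.sum_lt_sum (fun e he => ?_) ⟨s(u, v), by simpa using huv, hlt⟩
  induction e with
  | _ u v => exact h u v (by simpa using he)

lemma treeLength_comp_le [MetricSpace E] {T : SimpleGraph V} (x : V → E) (σ : Equiv.Perm V)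
    (hσ : ∀ u v, T.Adj u v → T.Adj (σ u) (σ v)) : treeLength T (x ∘ σ) ≤ treeLength T x := by
  classical
  unfold treeLength
  have hinj : Function.Injective (Sym2.map σ) := Sym2.map.injective σ.injective
  have hsub : T.edgeFinset.image (Sym2.map σ) ⊆ T.edgeFinset := by
    refine Finset.image_subset_iff.2 fun e he => ?_
    induction e with
    | _ u v => simpa using hσ u v (by simpa using he)
  calc _ = ∑ e ∈ T.edgeFinset.image (Sym2.map σ),
        Sym2.lift ⟨fun u v => dist (x u) (x v), fun _ _ => dist_comm _ _⟩ e := by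
        rw [Finset.sum_image hinj.injOn]
        refine Finset.sum_congr rfl fun e _ => ?_
        induction e with
        | _ u v => rfl
    _ ≤ _ := by
        refine Finset.sum_le_sum_of_subset_of_nonneg hsub fun e _ _ => ?_
        induction e with
        | _ u v => exact dist_nonneg

/-- Twice the length of the midpoint placement is at most the sum of the two lengths, with strict
inequality if a pair of corresponding edge vectors is not on a common ray. -/
lemma two_mul_treeLength_midpoint_lt [NormedAddCommGroup E] [NormedSpace ℝ E]
    [StrictConvexSpace ℝ E] {T : SimpleGraph V} {x y : V → E} {u v : V} (huv : T.Adj u v)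
    (hray : ¬ SameRay ℝ (x u - x v) (y u - y v)) :
    2 * treeLength T (fun w => (2⁻¹ : ℝ) • (x w + y w)) < treeLength T x + treeLength T y := by
  classical
  have key : ∀ u v, 2 * dist ((2⁻¹ : ℝ) • (x u + y u)) ((2⁻¹ : ℝ) • (x v + y v)) =
      ‖(x u - x v) + (y u - y v)‖ := fun u v => by
    rw [dist_eq_norm, ← smul_sub, norm_smul, add_sub_add_comm]
    norm_num
    ring
  unfold treeLength
  rw [Finset.mul_sum, ← Finset.sum_add_distrib]
  refine Finset.sum_lt_sum (fun e he => ?_) ⟨s(u, v), by simpa using huv, ?_⟩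
  · induction e with
    | _ u v =>
      simp only [Sym2.lift_mk, key]
      rw [dist_eq_norm, dist_eq_norm]
      exact norm_add_le _ _
  · simp only [Sym2.lift_mk, key]
    rw [dist_eq_norm, dist_eq_norm]
    exact norm_add_lt_of_not_sameRay hray

end Length

/-! ### Rigidity of minimal placements. -/

section Minimal

variable {ι S E : Type*} [Fintype ι] [Fintype S] {T : SimpleGraph (ι ⊕ S)} {p : ι → E}

/-- In two minimal placements, corresponding edges of equal length are equal as vectors. -/
lemma IsRelativelyMinimal.sub_eq_sub [NormedAddCommGroup E] [NormedSpace ℝ E]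
    [StrictConvexSpace ℝ E] {x y : ι ⊕ S → E}
    (hx : IsRelativelyMinimal T p x) (hy : IsRelativelyMinimal T p y) {u v : ι ⊕ S}
    (huv : T.Adj u v) (hd : dist (x u) (x v) = dist (y u) (y v)) : x u - x v = y u - y v := by
  rw [dist_eq_norm, dist_eq_norm] at hd
  rw [← sameRay_iff_of_norm_eq hd]
  by_contra hray
  -- Otherwise the midpoint placement would be strictly shorter than the average of two minimal
  -- lengths.
  have h1 := two_mul_treeLength_midpoint_lt huv hray
  have h2 := hx.minimal y hy.terminal
  have h3 := hy.minimal (fun w => (2⁻¹ : ℝ) • (x w + y w)) fun i => by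
    simp only [hx.terminal, hy.terminal, ← two_smul ℝ (p i), smul_smul]
    norm_num
  linarith

lemma IsRelativelyMinimal.of_le [MetricSpace E] {x y : ι ⊕ S → E}
    (hx : IsRelativelyMinimal T p x) (hy : ∀ i, y (Sum.inl i) = p i)
    (hle : treeLength T y ≤ treeLength T x) : IsRelativelyMinimal T p y :=
  ⟨hy, fun z hz => hle.trans (hx.minimal z hz)⟩

/-- An isometry that fixes the terminals fixes a minimal placement. -/
lemma IsRelativelyMinimal.isometry_fixes [NormedAddCommGroup E] [NormedSpace ℝ E]
    [StrictConvexSpace ℝ E] [Nonempty ι] (hT : T.Connected) {x : ι ⊕ S → E}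
    (hx : IsRelativelyMinimal T p x) {Φ : E → E} (hΦ : Isometry Φ) (hp : ∀ i, Φ (p i) = p i)
    (v : ι ⊕ S) : Φ (x v) = x v := by
  have hy : IsRelativelyMinimal T p (Φ ∘ x) :=
    hx.of_le (fun i => by simp [hx.terminal, hp])
      (treeLength_le_of_forall fun u v _ => (hΦ.dist_eq _ _).le)
  obtain ⟨i⟩ := ‹Nonempty ι›
  have hreach := (SimpleGraph.reachable_iff_reflTransGen _ _).1 (hT.preconnected (Sum.inl i) v)
  induction hreach with
  | refl => rw [hx.terminal, hp]
  | tail _ huv ih =>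
    have := hx.sub_eq_sub hy huv (hΦ.dist_eq _ _).symm
    simp only [Function.comp_apply, ih] at this
    exact (sub_right_injective this).symm

/-- Applying an isometry that fixes the terminals of `W` to the part `W` of a minimal placement
does not shorten the only edge that leaves `W`. -/
lemma IsRelativelyMinimal.dist_le_of_isometry [MetricSpace E] {x : ι ⊕ S → E}
    (hx : IsRelativelyMinimal T p x) {W : Set (ι ⊕ S)} {r q : ι ⊕ S} (hr : r ∈ W) (hq : q ∉ W)
    (hadj : T.Adj r q) (hexit : ∀ u ∈ W, ∀ v ∉ W, T.Adj u v → u = r ∧ v = q)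
    {Φ : E → E} (hΦ : Isometry Φ) (hp : ∀ i, Sum.inl i ∈ W → Φ (p i) = p i) :
    dist (x r) (x q) ≤ dist (Φ (x r)) (x q) := by
  classical
  by_contra! hlt
  set y : ι ⊕ S → E := fun v => if v ∈ W then Φ (x v) else x v with hy
  refine (treeLength_lt_of_forall (x := x) (y := y) ?_ hadj (by simpa [hy, hr, hq])).not_ge
    (hx.minimal y fun i => ?_)
  · intro u v huv
    by_cases hu : u ∈ W <;> by_cases hv : v ∈ W
    · simp [hy, hu, hv, hΦ.dist_eq]
    · obtain ⟨rfl, rfl⟩ := hexit u hu v hv huv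
      simpa [hy, hu, hv] using hlt.le
    · obtain ⟨rfl, rfl⟩ := hexit v hv u hu huv.symm
      simpa [hy, hu, hv, dist_comm] using hlt.le
    · simp [hy, hu, hv]
  · by_cases hi : Sum.inl i ∈ W
    · simp [hy, hi, hx.terminal, hp i hi]
    · simp [hy, hi, hx.terminal]

end Minimal

lemma mem_terminalsIn {ι S : Type*} [Fintype ι] {W : Set (ι ⊕ S)} {i : ι} :
    i ∈ terminalsIn W ↔ Sum.inl i ∈ W := by
  simp [terminalsIn]

/-! ### Equality of coordinates by symmetry. -/

section Simplex

variable {n : ℕ} {S : Type*} [Fintype S] {T : SimpleGraph (Fin n ⊕ S)}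
  {x : Fin n ⊕ S → EuclideanSpace ℝ (Fin n)}

/-- Vertices outside a full binary subtree, and its root, have equal coordinates at all the
terminals of the subtree. -/
lemma IsRelativelyMinimal.coord_eq_coord (hT : IsSteinerTopology T)
    (hx : IsRelativelyMinimal T (simplexVertex n) x) {h : ℕ} {q r : Fin n ⊕ S}
    {W : Set (Fin n ⊕ S)} (hW : IsFullBinarySubtree T h q r W) {v : Fin n ⊕ S}
    (hv : v ∉ W ∨ v = r) {i j : Fin n} (hi : Sum.inl i ∈ W) (hj : Sum.inl j ∈ W) :
    x v i = x v j := by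
  induction hW generalizing v i j with
  | leaf q k hk =>
    simp only [Set.mem_singleton_iff, Sum.inl.injEq] at hi hj
    rw [hi, hj]
  | node h q s a b A B hs hqa hqb hab hA hB ihA ihB =>
    obtain ⟨π, τ, hfix, hmA, hadj⟩ := IsFullBinarySubtree.exists_automorphism
      hT.isTree.connected hab hA hB
    have hW := IsFullBinarySubtree.node h q s a b A B hs hqa hqb hab hA hB
    set W := {Sum.inr s} ∪ A ∪ B with hWdef
    set O : Set (Fin n ⊕ S) := {v | v ∉ W ∨ v = Sum.inr s} with hO
    have hOA : ∀ v ∈ O, v ∉ A := by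
      rintro v (hv | rfl)
      · exact fun hm => hv (Or.inl (Or.inr hm))
      · exact hA.parent_notMem
    have hOB : ∀ v ∈ O, v ∉ B := by
      rintro v (hv | rfl)
      · exact fun hm => hv (Or.inr hm)
      · exact hB.parent_notMem
    set σ := Equiv.sumCongr π τ with hσ
    -- The inverse permutation sends the vertex labelled `π i` back to the one labelled `i`, so `y`
    -- keeps the terminals in place.
    set P := LinearIsometryEquiv.piLpCongrLeft 2 ℝ ℝ π.symm with hP
    have hPapp : ∀ z i, P z i = z (π i) := fun z i => by
      simp [hP, LinearIsometryEquiv.piLpCongrLeft_apply, Equiv.piCongrLeft']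
    set y : Fin n ⊕ S → EuclideanSpace ℝ (Fin n) := fun v => P (x (σ v)) with hydef
    have hy : IsRelativelyMinimal T (simplexVertex n) y := by
      refine hx.of_le (fun i => ?_) ((treeLength_le_of_forall fun u v _ => ?_).trans
        (treeLength_comp_le x σ hadj))
      · simp only [hydef, hσ, Equiv.sumCongr_apply, Sum.map_inl, hx.terminal, simplexVertex]
        simp [hP]
      · exact (P.isometry.dist_eq _ _).le
    have hyO : ∀ v ∈ O, y v = P (x v) := fun v hv => by
      simp only [hydef, hfix v (hOA v hv) (hOB v hv)]
    have hcst : ∀ u ∈ O, ∀ v ∈ O, T.Adj u v → x u - x v = y u - y v := fun u hu v hv huv =>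
      hx.sub_eq_sub hy huv (by rw [hyO u hu, hyO v hv, P.isometry.dist_eq])
    have hqO : q ∈ O := Or.inl hW.parent_notMem
    have hclosed : ∀ u ∈ O, u ≠ Sum.inr s → ∀ v, T.Adj u v → v ∈ O := by
      intro u hu hus v huv
      by_contra hvO
      simp only [hO, Set.mem_ofPred_eq, not_or, not_not] at hvO
      exact hvO.2 (hW.eq_of_adj hvO.1 (hu.resolve_right hus) huv.symm).1
    -- `hcst` carries a nonzero difference `x - y` from a vertex of `O` to its neighbours in `O`; at
    -- the root, `q` serves as the required neighbour.
    have hempty := hT.eq_empty_of_closed (Sum.inr s) {v | v ∈ O ∧ x v ≠ y v}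
      (fun i hi => hi.2 (by rw [hx.terminal, hy.terminal]))
      (fun hsK => ⟨q, ⟨hqO, fun heq => hsK.2 (by
        have := hcst _ hsK.1 q hqO hW.adj
        rwa [heq, sub_left_inj] at this)⟩, hW.adj⟩)
      (fun u hu hus v huv => by
        have hvO := hclosed u hu.1 hus v huv
        refine ⟨hvO, fun heq => hu.2 ?_⟩
        have := hcst u hu.1 v hvO huv
        rwa [heq, sub_left_inj] at this)
    have hswap : ∀ v ∈ O, ∀ i, x v i = x v (π i) := fun v hv i => by
      have hxy : x v = y v := by
        by_contra hne
        exact (Set.eq_empty_iff_forall_notMem.1 hempty) v ⟨hv, hne⟩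
      conv_lhs => rw [hxy, hyO v hv, hPapp]
    have hsplit : ∀ k : Fin n, Sum.inl k ∈ W → Sum.inl k ∈ A ∨ Sum.inl k ∈ B := by
      rintro k ((hk | hk) | hk)
      · simp at hk
      · exact Or.inl hk
      · exact Or.inr hk
    have hAB : ∀ i j : Fin n, Sum.inl i ∈ A → Sum.inl j ∈ B → x v i = x v j := fun i j hi hj => by
      rw [hswap v hv i]
      exact ihB (Or.inl (hOB v hv)) (by simpa [hσ] using hmA _ hi) hj
    rcases hsplit i hi with hi | hi <;> rcases hsplit j hj with hj | hj
    · exact ihA (Or.inl (hOA v hv)) hi hj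
    · exact hAB i j hi hj
    · exact (hAB j i hj hi).symm
    · exact ihB (Or.inl (hOB v hv)) hi hj

end Simplex

/-! ### Euclidean geometry of the edge and the centroid. -/

section Ray

variable {E : Type*} [NormedAddCommGroup E] [InnerProductSpace ℝ E]

open scoped InnerProductSpace

/-- If no isometry that fixes the orthogonal complement of `ξ` and `η` brings `c + ξ` closer to
`d + η`, where `c` and `d` are orthogonal to `ξ` and `η`, then `ξ` and `η` are on a common ray. -/
lemma sameRay_of_forall_isometry {c d ξ η : E} (hcξ : ⟪c, ξ⟫_ℝ = 0) (hcη : ⟪c, η⟫_ℝ = 0)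
    (hdξ : ⟪d, ξ⟫_ℝ = 0) (hdη : ⟪d, η⟫_ℝ = 0)
    (hmin : ∀ R : E ≃ₗᵢ[ℝ] E, (∀ z, ⟪z, ξ⟫_ℝ = 0 → ⟪z, η⟫_ℝ = 0 → R z = z) →
      dist (c + ξ) (d + η) ≤ dist (R (c + ξ)) (d + η)) : SameRay ℝ ξ η := by
  rcases eq_or_ne η 0 with rfl | hη
  · exact SameRay.zero_right _
  have hη' : ‖η‖ ≠ 0 := norm_ne_zero_iff.2 hη
  set w : E := (‖ξ‖ / ‖η‖) • η with hw
  have hwn : ‖ξ‖ = ‖w‖ := by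
    rw [hw, norm_smul, Real.norm_of_nonneg (by positivity), div_mul_cancel₀ _ hη']
  set R := Submodule.reflection (ℝ ∙ (ξ - w))ᗮ with hR
  have hfix : ∀ z, ⟪z, ξ⟫_ℝ = 0 → ⟪z, η⟫_ℝ = 0 → R z = z := fun z h1 h2 => by
    refine Submodule.reflection_mem_subspace_eq_self ?_
    rw [Submodule.mem_orthogonal_singleton_iff_inner_left, inner_sub_right, hw,
      real_inner_smul_right, h1, h2]
    simp
  have hRξ : R ξ = w := Submodule.reflection_sub hwn
  have h := hmin R hfix
  have hcw : ⟪c, w⟫_ℝ = 0 := by rw [hw, real_inner_smul_right, hcη, mul_zero]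
  have hwd : ⟪w, d⟫_ℝ = 0 := by
    rw [hw, real_inner_smul_left, real_inner_comm, hdη, mul_zero]
  have hξd : ⟪ξ, d⟫_ℝ = 0 := by rw [real_inner_comm, hdξ]
  have hwη : ⟪w, η⟫_ℝ = ‖ξ‖ * ‖η‖ := by
    rw [hw, real_inner_smul_left, real_inner_self_eq_norm_sq]
    field_simp
  rw [map_add, hfix c hcξ hcη, hRξ, dist_eq_norm, dist_eq_norm,
    ← sq_le_sq₀ (norm_nonneg _) (norm_nonneg _)] at h
  simp only [norm_sub_sq_real, norm_add_sq_real, inner_add_left, inner_add_right, hcξ, hcw, hwd,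
    hξd, hwη, ← hwn] at h
  -- This is the equality case of Cauchy–Schwarz: after squaring, only the `η`-products with `ξ` and
  -- `w` differ.
  have hle : ‖ξ‖ * ‖η‖ ≤ ⟪ξ, η⟫_ℝ := by linarith
  rw [sameRay_iff_norm_smul_eq]
  exact (inner_eq_norm_mul_iff_real.1 (le_antisymm (real_inner_le_norm ξ η) hle)).symm

/-- If `u` and `w` are combinations of `c` with two vectors on a common ray, with the total weight
measured by `f` equal to one, then `c` is on the line through `u` and `w`. -/
lemma mem_affineSpan_pair_of_sameRay {c ξ η : E} (f : E →ₗ[ℝ] ℝ) (h : SameRay ℝ ξ η)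
    (hne : (1 - f ξ) • c + ξ ≠ (1 - f η) • c + η) :
    c ∈ affineSpan ℝ {(1 - f ξ) • c + ξ, (1 - f η) • c + η} := by
  rcases eq_or_ne ξ 0 with rfl | hξ
  · simpa using left_mem_affineSpan_pair ℝ c ((1 - f η) • c + η)
  rcases eq_or_ne η 0 with rfl | hη
  · simpa using right_mem_affineSpan_pair ℝ ((1 - f ξ) • c + ξ) c
  obtain ⟨k, -, rfl⟩ := h.exists_pos_left hξ hη
  have hk : 1 - k ≠ 0 := fun hk => hne (by
    rw [← sub_eq_zero.1 hk, one_smul])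
  -- With `η = k • ξ`, the parameter `t = 1 / (1 - k)` solves `(1 - t) + t * k = 0`, which cancels
  -- `ξ` and leaves weight 1 on `c`.
  have : AffineMap.lineMap ((1 - f ξ) • c + ξ) ((1 - f (k • ξ)) • c + k • ξ) (1 / (1 - k)) = c := by
    rw [AffineMap.lineMap_apply_module, map_smul, smul_eq_mul]
    match_scalars <;> field_simp <;> ring
  have hmem := AffineMap.lineMap_mem_affineSpan_pair (1 / (1 - k)) ((1 - f ξ) • c + ξ)
    ((1 - f (k • ξ)) • c + k • ξ)
  rwa [this] at hmem

end Ray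

/-! ### The affine hull of the simplex and its centroids. -/

section Simplex

variable {n : ℕ} {S : Type*} [Fintype S] {T : SimpleGraph (Fin n ⊕ S)}
  {x : Fin n ⊕ S → EuclideanSpace ℝ (Fin n)}

/-- A relatively minimal tree of the simplex lies in the affine hull of the simplex. -/
lemma IsRelativelyMinimal.sum_coord (hn : 0 < n) (hT : T.Connected)
    (hx : IsRelativelyMinimal T (simplexVertex n) x) (v : Fin n ⊕ S) : ∑ i, x v i = 1 := by
  have : Nonempty (Fin n) := ⟨⟨0, hn⟩⟩
  set s := affineSpan ℝ (Set.range (simplexVertex n)) with hs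
  have : Nonempty s := (Set.range_nonempty (simplexVertex n)).to_subtype.map
    (Set.inclusion (subset_affineSpan ℝ _))
  -- Reflection in the affine hull fixes every terminal, hence every point of the placement.
  have hfix := hx.isometry_fixes hT (EuclideanGeometry.reflection s).isometry
    (fun i => (EuclideanGeometry.reflection_eq_self_iff _).2
      (subset_affineSpan ℝ _ (Set.mem_range_self i))) v
  have hmem := (EuclideanGeometry.reflection_eq_self_iff _).1 hfix
  obtain ⟨w, hw1, hw⟩ := eq_affineCombination_of_mem_affineSpan_of_fintype hmem
  rw [hw, Finset.affineCombination_eq_linear_combination _ _ _ hw1, ← hw1]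
  refine Finset.sum_congr rfl fun i _ => ?_
  simp [simplexVertex, Finset.sum_apply, Pi.single_apply]

lemma centroid_simplexVertex_apply {P : Finset (Fin n)} (hP : P.Nonempty) (i : Fin n) :
    P.centroid ℝ (simplexVertex n) i = if i ∈ P then (P.card : ℝ)⁻¹ else 0 := by
  rw [Finset.centroid_def, Finset.affineCombination_eq_linear_combination _ _ _
    (P.sum_centroidWeights_eq_one_of_nonempty ℝ hP)]
  simp [simplexVertex, Pi.single_apply]

end Simplex

/-! ### Assembly of the two claims. -/

theorem mainTheorem5 {n : ℕ} {S : Type*} [Fintype S]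
    (T : SimpleGraph (Fin n ⊕ S)) (hT : IsSteinerTopology T)
    (x : Fin n ⊕ S → EuclideanSpace ℝ (Fin n))
    (hx : IsRelativelyMinimal T (simplexVertex n) x)
    (h : ℕ) (q : Fin n ⊕ S) (r : S) (W : Set (Fin n ⊕ S))
    (hW : IsFullBinarySubtree T h q (Sum.inr r) W) :
    (∀ s : S, (Sum.inr s ∉ W ∨ s = r) →
      ∀ i ∈ terminalsIn W, ∀ j ∈ terminalsIn W, x (Sum.inr s) i = x (Sum.inr s) j) ∧
    (x (Sum.inr r) ≠ x q →
      (terminalsIn W).centroid ℝ (simplexVertex n) ∈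
        affineSpan ℝ {x (Sum.inr r), x q}) := by
  classical
  refine ⟨fun s hs i hi j hj => hx.coord_eq_coord hT hW
    (hs.imp id (congrArg Sum.inr)) (mem_terminalsIn.1 hi) (mem_terminalsIn.1 hj), fun hne => ?_⟩
  set P := terminalsIn W with hP
  obtain ⟨i₀, hi₀⟩ := hW.exists_terminal
  have hPne : P.Nonempty := ⟨i₀, mem_terminalsIn.2 hi₀⟩
  have hcard : (P.card : ℝ) ≠ 0 := by exact_mod_cast hPne.card_ne_zero
  set c := P.centroid ℝ (simplexVertex n) with hc
  let f : EuclideanSpace ℝ (Fin n) →ₗ[ℝ] ℝ := ∑ i, EuclideanSpace.projₗ i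
  have hf : ∀ z, f z = ∑ i, z i := fun z => by simp [f]
  let off : EuclideanSpace ℝ (Fin n) → EuclideanSpace ℝ (Fin n) := fun z =>
    WithLp.toLp 2 fun i => if i ∈ P then 0 else z i
  have hoff : ∀ z i, off z i = if i ∈ P then 0 else z i := fun z i => rfl
  have hdecomp : ∀ v, (v ∉ W ∨ v = Sum.inr r) → x v = (1 - f (off (x v))) • c + off (x v) := by
    intro v hv
    have hsum := hx.sum_coord i₀.pos hT.isTree.connected v
    have hconst : ∀ i ∈ P, x v i = x v i₀ := fun i hi =>
      hx.coord_eq_coord hT hW hv (mem_terminalsIn.1 hi) hi₀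
    -- Since all coordinates sum to 1, the mass on `P` is what `off` leaves over, and part 1 spreads
    -- it evenly.
    have hmass : 1 - f (off (x v)) = P.card * x v i₀ := by
      rw [hf, ← hsum, ← Finset.sum_sub_distrib, ← nsmul_eq_mul, ← Finset.sum_const,
        ← Finset.sum_subset (Finset.subset_univ P)]
      · exact Finset.sum_congr rfl fun i hi => by simp [hoff, hi, hconst i hi]
      · intro i _ hi
        simp [hoff, hi]
    ext i
    by_cases hi : i ∈ P
    · simp [hmass, hoff, hc, centroid_simplexVertex_apply hPne, hi, hconst i hi]
      field_simp
    · simp [hoff, hc, centroid_simplexVertex_apply hPne, hi]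
  have horth : ∀ z w : EuclideanSpace ℝ (Fin n), (∀ i ∉ P, z i = 0) → inner ℝ z (off w) = 0 := by
    intro z w hz
    rw [PiLp.inner_apply]
    refine Finset.sum_eq_zero fun i _ => ?_
    by_cases hi : i ∈ P
    · simp [hoff, hi]
    · simp [hz i hi]
  have hc0 : ∀ t : ℝ, ∀ i ∉ P, (t • c) i = 0 := fun t i hi => by
    simp [hc, centroid_simplexVertex_apply hPne, hi]
  have hr := hdecomp (Sum.inr r) (Or.inr rfl)
  have hq := hdecomp q (Or.inl hW.parent_notMem)
  have hray : SameRay ℝ (off (x (Sum.inr r))) (off (x q)) := by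
    refine sameRay_of_forall_isometry (horth _ _ (hc0 _)) (horth _ _ (hc0 _)) (horth _ _ (hc0 _))
      (horth _ _ (hc0 _))
      (c := (1 - f (off (x (Sum.inr r)))) • c) (d := (1 - f (off (x q))) • c) fun R hR => ?_
    rw [← hr, ← hq]
    refine hx.dist_le_of_isometry hW.root_mem hW.parent_notMem hW.adj
      -- Terminals of `W` have no coordinates off `P`, so they are orthogonal to both `off` vectors
      -- and `R` fixes them.
      (fun u hu v hv huv => hW.eq_of_adj hu hv huv) R.isometry fun i hi => ?_
    have hi0 : ∀ j ∉ P, simplexVertex n i j = 0 := fun j hj => by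
      have : j ≠ i := fun e => hj (e ▸ mem_terminalsIn.2 hi)
      simp [simplexVertex, this]
    exact hR _ (horth _ _ hi0) (horth _ _ hi0)
  rw [hr, hq] at hne ⊢
  exact mem_affineSpan_pair_of_sameRay f hray hne
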